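/- Let $N\ge 1$ be an integer. Then there is a constant $D=D(N)>0$, depending only on $N$, with the following property. Let $(X,d)$ be a metric space with doubling constant $N$, i.e. for every $r>0$ every open ball of radius $2r$ in $X$ can be covered by at most $N$ open balls of radius $r$. Then for every $\varepsilon>0$ there exist a uniform simplicial complex $P$ of dimension $\lfloor\log_2 N\rfloor$ and a map $F\colon X\to P$ that is $\varepsilon$-Lipschitz and $D/\varepsilon$-cobounded. Here a simplicial complex $P$ with vertex set $P^0$ is called uniform if it is realized in $\ell^2(P^0)$, each vertex being the corresponding standard basis vector and each simplex the convex hull of its vertices, and carries the restriction of the Euclidean metric of $\ell^2(P^0)$; its dimension is the supremum of the dimensions of its simplices. For $D'>0$, a map $F\colon X\to P$ is $D'$-cobounded if $\operatorname{diam}F^{-1}(\sigma)\le D'$ for every simplex $\sigma$ of $P$. -/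

import Mathlib

universe u

/-- `N` is a doubling constant of the metric space `X`: for every `r > 0`, every open ball of
radius `2 r` is covered by at most `N` open balls of radius `r`. -/
def IsDoublingConstant (X : Type u) [MetricSpace X] (N : ℕ) : Prop :=
  ∀ (x : X) (r : ℝ), 0 < r →
    ∃ t : Finset X, t.card ≤ N ∧ Metric.ball x (2 * r) ⊆ ⋃ y ∈ t, Metric.ball y r

namespace UniformComplex

variable {V : Type u}

/-- The dimension of a simplicial complex, i.e. the supremum of the dimensions of its simplices.
A simplex with `k + 1` vertices has dimension `k` (faces are nonempty); the empty complex has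
dimension `⊥`. -/
noncomputable def dim (P : AbstractSimplicialComplex V) : WithBot ℕ∞ :=
  ⨆ s ∈ P.faces, (((s.card - 1 : ℕ) : ℕ∞) : WithBot ℕ∞)

/-- The closed simplex in `ℓ²(V)` spanned by the standard basis vectors indexed by `s`, described
by barycentric coordinates. -/
def simplex (s : Finset V) : Set (lp (fun _ : V => ℝ) 2) :=
  {y | (∀ v, 0 ≤ y v) ∧ (∀ v, v ∉ s → y v = 0) ∧ ∑ v ∈ s, y v = 1}

/-- The uniform realization of a simplicial complex with vertex set `V`: the union of its closed
simplices in `ℓ²(V)`. As a subtype it carries the restriction of the `ℓ²` metric. -/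
def space (P : AbstractSimplicialComplex V) : Set (lp (fun _ : V => ℝ) 2) :=
  ⋃ s ∈ P.faces, simplex s

/-- A map into a uniform simplicial complex is `D`-cobounded if the preimage of every closed
simplex has diameter at most `D`. -/
def IsCobounded {X : Type u} [MetricSpace X] (P : AbstractSimplicialComplex V) (D : ℝ)
    (F : X → space P) : Prop :=
  ∀ s ∈ P.faces,
    Metric.ediam {x : X | (F x : lp (fun _ : V => ℝ) 2) ∈ simplex s} ≤ ENNReal.ofReal D

end UniformComplex

/-! A partition of unity subordinate to balls of size `r` gives a map to a complex of dimension at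
most N², Lipschitz with constant L/r, with vertex stars pulled back to sets of diameter at most r.
The dimension is then lowered one step at a time while it is some m with N < 2^m.

A top simplex contains K^m grid points with gaps of order 1/K. If the image came close to all of
them, the preimages would be K^m points in a ball of radius 2r with gaps of order r/(LK), so
doubling would bound their number by N^J with 2^J of order LK. For K = 2^j with j large, N < 2^m
excludes this (`IsStarBounded.exists_missed`). Radial projection from a missed point pushes the map
to the boundary (`IsStarBounded.exists_lower`): supports only shrink, so the star bound survives,
and L grows by a factor depending only on N, m and the previous L. The descent stops at m = ⌊log₂
N⌋; taking r proportional to 1/ε finishes the proof. -/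

/-- The sum of the coordinates of a finitely supported function. -/
noncomputable def Finsupp.mass {V : Type*} : (V →₀ ℝ) →ₗ[ℝ] ℝ :=
  Finsupp.linearCombination ℝ (fun _ => (1 : ℝ))

theorem Finsupp.mass_eq_sum {V : Type*} (f : V →₀ ℝ) {s : Finset V} (hs : f.support ⊆ s) :
    f.mass = ∑ v ∈ s, f v := by
  rw [Finsupp.mass, Finsupp.linearCombination_apply, Finsupp.sum_of_support_subset _ hs _ (by simp)]
  simp

/-- A map to the simplices of dimension at most `m` with vertices in `V`, in barycentric
coordinates, which is Lipschitz with constant `L / r` and for which preimages of open stars of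
vertices have diameter at most `r`. -/
structure IsStarBounded {X : Type*} [MetricSpace X] {V : Type*} (f : X → V →₀ ℝ) (m : ℕ)
    (L r : ℝ) : Prop where
  nonneg : ∀ x v, 0 ≤ f x v
  card_le : ∀ x, (f x).support.card ≤ m + 1
  mass_eq : ∀ x, (f x).mass = 1
  lip : ∀ x y v, |f x v - f y v| ≤ L / r * dist x y
  star : ∀ x y v, f x v ≠ 0 → f y v ≠ 0 → dist x y ≤ r

/-- The quotient of Lipschitz functions with values in the unit interval is Lipschitz when the
denominator is bounded below. -/
theorem abs_div_sub_div_le {n n' d d' a b c : ℝ} (hc : 0 < c) (hd : c ≤ d) (hd' : c ≤ d')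
    (hn : |n - n'| ≤ a) (hdd : |d - d'| ≤ b) (hn0 : 0 ≤ n') (hnd : n' ≤ d') :
    |n / d - n' / d'| ≤ (a + b) / c := by
  have h1 : 0 < d := hc.trans_le hd
  have h2 : 0 < d' := hc.trans_le hd'
  have e : n / d - n' / d' = ((n - n') - (n' / d') * (d - d')) / d := by
    field_simp; ring
  have hq : |n' / d'| ≤ 1 := by
    rw [abs_of_nonneg (by positivity)]; exact (div_le_one h2).mpr hnd
  have hnum : |(n - n') - (n' / d') * (d - d')| ≤ a + b := by
    refine (abs_sub _ _).trans (add_le_add hn ?_)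
    rw [abs_mul]
    exact (mul_le_of_le_one_left (abs_nonneg _) hq).trans hdd
  rw [e, abs_div, abs_of_pos h1]
  exact div_le_div₀ ((abs_nonneg _).trans hnum) hnum hc hd

/-! ### Doubling, separated sets and the initial partition of unity -/

section Doubling

variable {X : Type u} [MetricSpace X] {N : ℕ}

theorem IsDoublingConstant.exists_cover (h : IsDoublingConstant X N) (j : ℕ) (x : X) {r : ℝ}
    (hr : 0 < r) :
    ∃ t : Finset X, t.card ≤ N ^ j ∧ Metric.ball x (2 ^ j * r) ⊆ ⋃ y ∈ t, Metric.ball y r := by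
  classical
  induction j generalizing r with
  | zero => exact ⟨{x}, by simp, by simp⟩
  | succ j ih =>
    obtain ⟨t, ht, hs⟩ := ih (r := 2 * r) (by positivity)
    choose w hw hw' using fun y => h y r hr
    refine ⟨t.biUnion w, ?_, ?_⟩
    · rw [pow_succ]
      exact (Finset.card_biUnion_le_card_mul _ _ _ fun y _ => hw y).trans
        (Nat.mul_le_mul_right _ ht)
    · rw [pow_succ, mul_assoc]
      refine hs.trans ?_
      intro z hz
      simp only [Set.mem_iUnion, Finset.mem_biUnion] at hz ⊢
      obtain ⟨y, hy, hz⟩ := hz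
      have := hw' y hz
      simp only [Set.mem_iUnion] at this
      obtain ⟨q, hq, hz⟩ := this
      exact ⟨q, ⟨y, hy, hq⟩, hz⟩

/-- Finite families of separated points in a ball have bounded cardinality. -/
theorem IsDoublingConstant.card_le_of_separated (h : IsDoublingConstant X N) (j : ℕ) (x : X)
    {r : ℝ} (hr : 0 < r) {ι : Type*} (s : Finset ι) (p : ι → X)
    (hp : ∀ i ∈ s, p i ∈ Metric.ball x (2 ^ j * r))
    (hsep : ∀ i ∈ s, ∀ k ∈ s, i ≠ k → 2 * r ≤ dist (p i) (p k)) : s.card ≤ N ^ j := by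
  classical
  obtain ⟨t, ht, hs⟩ := h.exists_cover j x hr
  have hb : ∀ i : ι, ∃ y : X, i ∈ s → y ∈ t ∧ dist (p i) y < r := by
    intro i
    by_cases hi : i ∈ s
    · have := hs (hp i hi)
      simp only [Set.mem_iUnion, Metric.mem_ball] at this
      obtain ⟨y, hy, hd⟩ := this
      exact ⟨y, fun _ => ⟨hy, hd⟩⟩
    · exact ⟨x, fun h => absurd h hi⟩
  choose b hb using hb
  refine (Finset.card_le_card_of_injOn b (fun i hi => (hb i hi).1) ?_).trans ht
  intro i hi k hk hik
  by_contra hne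
  have h1 := (hb i hi).2
  have h2 := (hb k hk).2
  rw [← hik] at h2
  linarith [hsep i hi k hk hne, dist_triangle_right (p i) (p k) (b i)]

theorem exists_maximal_separated (X : Type*) [MetricSpace X] {ρ : ℝ} (hρ : 0 < ρ) :
    ∃ A : Set X, (A.Pairwise fun a b => ρ ≤ dist a b) ∧ ∀ x, ∃ a ∈ A, dist x a < ρ := by
  obtain ⟨A, hA⟩ := zorn_subset {A : Set X | A.Pairwise fun a b => ρ ≤ dist a b} (by
    intro c hc hchain
    exact ⟨⋃₀ c, (Set.pairwise_sUnion hchain.directedOn).2 fun s hs => hc hs,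
      fun s hs => Set.subset_sUnion_of_mem hs⟩)
  refine ⟨A, hA.prop, fun x => ?_⟩
  by_contra! hx
  have hins : (insert x A).Pairwise fun a b => ρ ≤ dist a b :=
    hA.prop.insert fun b hb _ => ⟨hx b hb, by rw [dist_comm]; exact hx b hb⟩
  have : x ∈ A := hA.le_of_ge hins (Set.subset_insert x A) (Set.mem_insert x A)
  have := hx x this
  rw [dist_self] at this
  linarith

/-- A doubling space has star bounded maps of some dimension: normalized bump functions. -/
theorem IsDoublingConstant.exists_isStarBounded (h : IsDoublingConstant X N) {r : ℝ} (hr : 0 < r) :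
    ∃ (V : Type u) (f : X → V →₀ ℝ),
      IsStarBounded f (N ^ 2) (4 * (1 + 2 * (N : ℝ) ^ 2)) r := by
  classical
  -- The bumps have radius 2ρ about a maximal ρ-separated set: two points under one bump are within
  -- 4ρ = r, and every total mass is at least ρ.
  obtain ⟨ρ, hρ, rfl⟩ : ∃ ρ : ℝ, 0 < ρ ∧ r = 4 * ρ := ⟨r / 4, by positivity, by ring⟩
  obtain ⟨A, hsep, hcov⟩ := exists_maximal_separated X hρ
  have hcard : ∀ (x : X) (s : Finset A), (∀ a ∈ s, dist x a < 2 * ρ) → s.card ≤ N ^ 2 := by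
    intro x s hs
    refine h.card_le_of_separated 2 x (half_pos hρ) s (fun a => (a : X)) ?_ ?_
    · intro a ha
      rw [Metric.mem_ball, dist_comm]
      linarith [hs a ha]
    · intro a _ b _ hab
      have := hsep a.2 b.2 (fun hc => hab (Subtype.ext hc))
      linarith
  have hfin : ∀ x : X, {a : A | dist x a < 2 * ρ}.Finite := by
    intro x
    by_contra hinf
    obtain ⟨t, ht, htc⟩ := Set.Infinite.exists_subset_card_eq hinf (N ^ 2 + 1)
    have := hcard x t fun a ha => ht ha
    omega
  have hφs : ∀ x : X, (Function.support fun a : A => max 0 (2 * ρ - dist x a)).Finite := by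
    intro x
    refine (hfin x).subset fun a ha => ?_
    by_contra hc
    simp only [Set.mem_ofPred_eq, not_lt] at hc
    exact ha (max_eq_left (by linarith))
  set φ : X → A →₀ ℝ := fun x => Finsupp.ofSupportFinite _ (hφs x) with hφ
  have hφa : ∀ x a, φ x a = max 0 (2 * ρ - dist x a) := fun x a => rfl
  have hφ0 : ∀ x a, 0 ≤ φ x a := fun x a => le_max_left _ _
  have hφd : ∀ x a, φ x a ≠ 0 → dist x a < 2 * ρ := by
    intro x a ha
    by_contra hc
    exact ha (max_eq_left (by linarith))
  have hφc : ∀ x, (φ x).support.card ≤ N ^ 2 := fun x =>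
    hcard x _ fun a ha => hφd x a (Finsupp.mem_support_iff.mp ha)
  have hφl : ∀ x y a, |φ x a - φ y a| ≤ dist x y := by
    intro x y a
    rw [hφa, hφa]
    refine (abs_max_sub_max_le_max _ _ _ _).trans (max_le (by simp) ?_)
    have := abs_dist_sub_le y x (a : X)
    rw [dist_comm y x] at this
    rwa [sub_sub_sub_cancel_left]
  have hms : ∀ x (s : Finset A), (φ x).support ⊆ s → (φ x).mass = ∑ a ∈ s, φ x a :=
    fun x s hs => Finsupp.mass_eq_sum _ hs
  have hmρ : ∀ x, ρ ≤ (φ x).mass := by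
    intro x
    obtain ⟨a, ha, hxa⟩ := hcov x
    have h1 : ρ ≤ φ x ⟨a, ha⟩ := by
      rw [hφa]; exact le_max_of_le_right (by simp only; linarith)
    have hmem : (⟨a, ha⟩ : A) ∈ (φ x).support := by
      rw [Finsupp.mem_support_iff]; exact (hρ.trans_le h1).ne'
    rw [hms x _ subset_rfl]
    exact h1.trans (Finset.single_le_sum (f := fun a => φ x a) (fun a _ => hφ0 x a) hmem)
  have hml : ∀ x y, |(φ x).mass - (φ y).mass| ≤ 2 * (N : ℝ) ^ 2 * dist x y := by
    intro x y
    rw [hms x _ Finset.subset_union_left, hms y _ (Finset.subset_union_right (s₁ := (φ x).support)),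
      ← Finset.sum_sub_distrib]
    refine (Finset.abs_sum_le_sum_abs _ _).trans ?_
    refine (Finset.sum_le_card_nsmul _ _ _ fun a _ => hφl x y a).trans ?_
    rw [nsmul_eq_mul]
    refine mul_le_mul_of_nonneg_right ?_ dist_nonneg
    have h1 := Finset.card_union_le (φ x).support (φ y).support
    have h2 := hφc x
    have h3 := hφc y
    have : ((φ x).support ∪ (φ y).support).card ≤ 2 * N ^ 2 := by omega
    exact_mod_cast this
  refine ⟨A, fun x => ((φ x).mass)⁻¹ • φ x, ?_, ?_, ?_, ?_, ?_⟩
  · intro x a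
    exact mul_nonneg (inv_nonneg.mpr (hρ.le.trans (hmρ x))) (hφ0 x a)
  · intro x
    exact (Finset.card_le_card Finsupp.support_smul).trans ((hφc x).trans (Nat.le_succ _))
  · intro x
    rw [map_smul, smul_eq_mul, inv_mul_cancel₀ (hρ.trans_le (hmρ x)).ne']
  · intro x y a
    simp only [Finsupp.smul_apply, smul_eq_mul, inv_mul_eq_div]
    have hle : φ y a ≤ (φ y).mass := by
      by_cases ha : a ∈ (φ y).support
      · rw [hms y _ subset_rfl]
        exact Finset.single_le_sum (f := fun a => φ y a) (fun a _ => hφ0 y a) ha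
      · rw [Finsupp.notMem_support_iff.mp ha]; exact hρ.le.trans (hmρ y)
    refine (abs_div_sub_div_le hρ (hmρ x) (hmρ y) (hφl x y a) (hml x y) (hφ0 y a) hle).trans_eq ?_
    field_simp
  · intro x y a hx hy
    have h1 := hφd x a fun hc => hx (by simp [hc])
    have h2 := hφd y a fun hc => hy (by simp [hc])
    linarith [dist_triangle_right x y (a : X)]

end Doubling

/-! ### Finding a missed point in each top simplex -/

/-- The ratio (N / 2^m)^j tends to 0, so it eventually absorbs the fixed factor N^i, which will
account for the Lipschitz constant. -/
theorem exists_pow_add_lt_two_pow {N m : ℕ} (h : N < 2 ^ m) (i : ℕ) :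
    ∃ j, N ^ (i + j) < (2 ^ j) ^ m := by
  have h2 : (0 : ℝ) < 2 ^ m := by positivity
  obtain ⟨j, hj⟩ := exists_pow_lt_of_lt_one (x := 1 / ((N : ℝ) ^ i + 1)) (by positivity)
    (y := (N : ℝ) / 2 ^ m) ((div_lt_one h2).mpr (by exact_mod_cast h))
  refine ⟨j, ?_⟩
  rw [div_pow, div_lt_div_iff₀ (by positivity) (by positivity)] at hj
  have h3 : (N : ℝ) ^ (i + j) < (2 ^ j) ^ m := by
    rw [pow_add, pow_right_comm]
    nlinarith [pow_nonneg (Nat.cast_nonneg N : (0 : ℝ) ≤ N) j]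
  exact_mod_cast h3

/-- Separated points well inside a simplex. -/
theorem exists_grid {V : Type*} {m : ℕ} (s : Finset V) (hs : s.card = m + 1) {K : ℕ} (hK : 0 < K) :
    ∃ p : (Fin m → Fin K) → V →₀ ℝ,
      (∀ a, (p a).support ⊆ s) ∧ (∀ a, ∀ v ∈ s, 1 / (2 * ((m : ℝ) + 1)) ≤ p a v) ∧
      (∀ a, (p a).mass = 1) ∧
      ∀ a b, a ≠ b → ∃ v, 1 / (2 * (K : ℝ) * ((m : ℝ) + 1)) ≤ |p a v - p b v| := by
  classical
  have hK' : (0 : ℝ) < K := by exact_mod_cast hK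
  have hm : (0 : ℝ) < (m : ℝ) + 1 := by positivity
  let e : Fin (m + 1) ≃ s := (s.equivFinOfCardEq hs).symm
  let E : Fin (m + 1) ↪ V := e.toEmbedding.trans (Function.Embedding.subtype _)
  -- All coordinates but one run over K equally spaced values between 1/(2(m+1)) and 1/(m+1); the
  -- remaining one completes the sum to 1 and so is at least 1/(m+1).
  let w : (Fin m → Fin K) → Fin m → ℝ := fun a i =>
    ((K : ℝ) + (a i : ℕ)) / (2 * K * ((m : ℝ) + 1))
  let q : (Fin m → Fin K) → Fin (m + 1) → ℝ := fun a => Fin.cons (1 - ∑ i, w a i) (w a)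
  have hw1 : ∀ a i, 1 / (2 * ((m : ℝ) + 1)) ≤ w a i := by
    intro a i
    have : 1 / (2 * ((m : ℝ) + 1)) = (K : ℝ) / (2 * K * ((m : ℝ) + 1)) := by field_simp
    rw [this]
    exact div_le_div_of_nonneg_right (by simp) (by positivity)
  have hw2 : ∀ a i, w a i ≤ 1 / ((m : ℝ) + 1) := by
    intro a i
    have : 1 / ((m : ℝ) + 1) = ((K : ℝ) + K) / (2 * K * ((m : ℝ) + 1)) := by field_simp; ring
    rw [this]
    have : ((a i : ℕ) : ℝ) ≤ K := by exact_mod_cast (a i).2.le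
    exact div_le_div_of_nonneg_right (by linarith) (by positivity)
  have hws : ∀ a, ∑ i, w a i ≤ 1 - 1 / ((m : ℝ) + 1) := by
    intro a
    refine (Finset.sum_le_card_nsmul _ _ _ fun i _ => hw2 a i).trans_eq ?_
    rw [Finset.card_univ, Fintype.card_fin, nsmul_eq_mul]
    field_simp
    ring
  have hpE : ∀ a i, (Finsupp.equivFunOnFinite.symm (q a)).embDomain E (E i) = q a i := by
    intro a i
    rw [Finsupp.embDomain_apply_self]; rfl
  refine ⟨fun a => (Finsupp.equivFunOnFinite.symm (q a)).embDomain E, ?_, ?_, ?_, ?_⟩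
  · intro a v hv
    rw [Finsupp.support_embDomain, Finset.mem_map] at hv
    obtain ⟨i, _, rfl⟩ := hv
    exact (e i).2
  · intro a v hv
    obtain ⟨i, hi⟩ := e.surjective ⟨v, hv⟩
    have hi' : E i = v := congrArg Subtype.val hi
    rw [← hi', hpE]
    refine Fin.cases ?_ (fun i => ?_) i
    · have h1 : 1 / (2 * ((m : ℝ) + 1)) ≤ 1 / ((m : ℝ) + 1) :=
        one_div_le_one_div_of_le hm (by linarith)
      simp only [q, Fin.cons_zero]
      linarith [hws a]
    · simpa only [q, Fin.cons_succ] using hw1 a i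
  · intro a
    rw [Finsupp.mass, Finsupp.linearCombination_embDomain, Finsupp.linearCombination_apply,
      Finsupp.sum_fintype _ _ (by simp), Fin.sum_univ_succ]
    simp [q]
  · intro a b hab
    obtain ⟨i, hi⟩ := Function.ne_iff.mp hab
    refine ⟨E i.succ, ?_⟩
    rw [hpE, hpE]
    simp only [q, Fin.cons_succ, w]
    rw [← sub_div, abs_div, abs_of_pos (by positivity : (0 : ℝ) < 2 * K * ((m : ℝ) + 1))]
    refine div_le_div_of_nonneg_right ?_ (by positivity)
    rw [add_sub_add_left_eq_sub]
    have : ((a i : ℕ) : ℤ) - (b i : ℕ) ≠ 0 := by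
      rw [sub_ne_zero]
      exact fun hc => hi (Fin.ext (by exact_mod_cast hc))
    exact_mod_cast Int.one_le_abs this

/-- The differences q - (1 - c)p are nonnegative on s and sum to c, so each is at most c. This turns
the one-sided condition natural for radial projection into closeness. -/
theorem abs_sub_le_of_mass_eq_one {V : Type*} {s : Finset V} {p q : V →₀ ℝ} {c : ℝ} (hc : 0 ≤ c)
    (hps : p.support ⊆ s) (hqs : q.support ⊆ s) (hp : p.mass = 1) (hq : q.mass = 1)
    (hp0 : ∀ v ∈ s, 0 ≤ p v) (h : ∀ v ∈ s, (1 - c) * p v < q v) {v : V} (hv : v ∈ s) :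
    |q v - p v| ≤ c := by
  rw [Finsupp.mass_eq_sum _ hps] at hp
  rw [Finsupp.mass_eq_sum _ hqs] at hq
  have h1 : p v ≤ 1 := hp ▸ Finset.single_le_sum (f := fun v => p v) hp0 hv
  have h2 : q v - (1 - c) * p v ≤ ∑ w ∈ s, (q w - (1 - c) * p w) :=
    Finset.single_le_sum (f := fun w => q w - (1 - c) * p w)
      (fun w hw => (sub_pos.mpr (h w hw)).le) hv
  rw [Finset.sum_sub_distrib, ← Finset.mul_sum, hp, hq] at h2
  have h3 := h v hv
  have h4 := hp0 v hv
  rw [abs_le]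
  constructor <;> nlinarith

/-- In a simplex of dimension larger than the doubling exponent, the image of a star bounded map
misses a neighbourhood of some point well inside the simplex. -/
theorem IsStarBounded.exists_missed {X : Type*} [MetricSpace X] {N : ℕ}
    (hX : IsDoublingConstant X N) {V : Type*} {f : X → V →₀ ℝ} {m : ℕ} {L r : ℝ}
    (hf : IsStarBounded f m L r) (hL : 0 < L) (hr : 0 < r) {K J : ℕ} (hK : 0 < K)
    (hKJ : 16 * L * K * ((m : ℝ) + 1) ≤ 2 ^ J) (hN : N ^ J < K ^ m) (s : Finset V)
    (hs : s.card = m + 1) :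
    ∃ p : V →₀ ℝ, p.support ⊆ s ∧ (∀ v ∈ s, 1 / (2 * ((m : ℝ) + 1)) ≤ p v) ∧ p.mass = 1 ∧
      ∀ x, (f x).support = s → ∃ v ∈ s, f x v ≤ (1 - 1 / (8 * (K : ℝ) * ((m : ℝ) + 1))) * p v := by
  classical
  obtain ⟨p, hps, hpl, hpm, hpd⟩ := exists_grid s hs hK
  have hK' : (0 : ℝ) < K := by exact_mod_cast hK
  have hm : (0 : ℝ) < (m : ℝ) + 1 := by positivity
  obtain ⟨c, hcdef⟩ : ∃ c : ℝ, c = 1 / (8 * (K : ℝ) * ((m : ℝ) + 1)) := ⟨_, rfl⟩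
  have hc : 0 < c := by rw [hcdef]; positivity
  have hh : 1 / (2 * (K : ℝ) * ((m : ℝ) + 1)) = 4 * c := by rw [hcdef]; field_simp; norm_num
  rw [hh] at hpd
  rw [← hcdef]
  have hp0 : ∀ a, ∀ v ∈ s, 0 ≤ p a v := fun a v hv => le_trans (by positivity) (hpl a v hv)
  by_contra hcon
  have hx : ∀ a, ∃ x, (f x).support = s ∧ ∀ v ∈ s, (1 - c) * p a v < f x v := by
    intro a
    by_contra! hno
    exact hcon ⟨p a, hps a, hpl a, hpm a, hno⟩
  choose x hxs hx using hx
  have hnear : ∀ a, ∀ v ∈ s, |f (x a) v - p a v| ≤ c := fun a v hv =>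
    abs_sub_le_of_mass_eq_one hc.le (hps a) (hxs a).subset (hpm a) (hf.mass_eq _) (hp0 a) (hx a) hv
  obtain ⟨v₀, hv₀⟩ : s.Nonempty := by rw [← Finset.card_pos]; omega
  have hdist : ∀ a b, dist (x a) (x b) ≤ r := fun a b =>
    hf.star _ _ v₀ (Finsupp.mem_support_iff.mp (hxs a ▸ hv₀))
      (Finsupp.mem_support_iff.mp (hxs b ▸ hv₀))
  have hJ : (0 : ℝ) < 2 ^ J := by positivity
  have hLc : 2 * L ≤ c * 2 ^ J := by
    rw [hcdef, one_div, inv_mul_eq_div, le_div_iff₀ (by positivity)]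
    linarith
  -- Grid gaps are 4c and each image is within c of its grid point, so images differ by 2c in some
  -- coordinate. The Lipschitz bound then gives gaps 4r/2^J in a ball of radius 2r.
  have hcard := hX.card_le_of_separated J (x fun _ => ⟨0, hK⟩) (r := 2 * r / 2 ^ J) (by positivity)
    (Finset.univ : Finset (Fin m → Fin K)) x ?_ ?_
  · rw [Finset.card_univ, Fintype.card_fun, Fintype.card_fin, Fintype.card_fin] at hcard
    omega
  · intro a _
    rw [mul_div_cancel₀ _ hJ.ne', Metric.mem_ball]
    linarith [hdist a fun _ => ⟨0, hK⟩]
  · intro a _ b _ hab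
    obtain ⟨v, hv⟩ := hpd a b hab
    have hvs : v ∈ s := by
      by_contra hvs
      rw [Finsupp.notMem_support_iff.mp fun h => hvs (hps a h),
        Finsupp.notMem_support_iff.mp fun h => hvs (hps b h), sub_zero, abs_zero] at hv
      linarith
    have h1 := abs_le.mp (hnear a v hvs)
    have h2 := abs_le.mp (hnear b v hvs)
    have h3 := abs_le.mp (hf.lip (x a) (x b) v)
    have h4 : 2 * c ≤ L / r * dist (x a) (x b) := by
      rcases le_abs.mp hv with hv | hv <;> linarith [h1.1, h1.2, h2.1, h2.2, h3.1, h3.2]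
    rw [div_mul_eq_mul_div, le_div_iff₀ hr] at h4
    rw [← mul_div_assoc, div_le_iff₀ hJ]
    have h5 : 2 * c * r * 2 ^ J ≤ L * dist (x a) (x b) * 2 ^ J :=
      mul_le_mul_of_nonneg_right h4 hJ.le
    have h6 : 2 * L * (2 * r) ≤ c * 2 ^ J * (2 * r) :=
      mul_le_mul_of_nonneg_right hLc (by positivity)
    refine le_of_mul_le_mul_left (a := L) ?_ hL
    linarith

/-! ### Radial projection to the boundary -/

/-- Radial projection away from missed points lowers the dimension of a star bounded map. -/
theorem IsStarBounded.exists_lower {X : Type*} [MetricSpace X] {V : Type*} {f : X → V →₀ ℝ}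
    {k : ℕ} {L r δ c : ℝ} (hf : IsStarBounded f (k + 1) L r) (hL : 0 < L) (hr : 0 < r)
    (hδ : 0 < δ) (hc : 0 < c) (hc1 : c ≤ 1)
    (hmiss : ∀ s : Finset V, s.card = k + 2 → ∃ p : V →₀ ℝ, p.support ⊆ s ∧ (∀ v ∈ s, δ ≤ p v) ∧
      p.mass = 1 ∧ ∀ x, (f x).support = s → ∃ v ∈ s, f x v ≤ (1 - c) * p v) :
    ∃ g : X → V →₀ ℝ, IsStarBounded g k (L * (1 + 2 / δ) / c) r := by
  classical
  have hp : ∀ s : Finset V, ∃ p : V →₀ ℝ, p.support ⊆ s ∧ (∀ v, 0 ≤ p v) ∧ (∀ v, p v ≤ 1) ∧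
      (s.card = k + 2 → (∀ v ∈ s, δ ≤ p v) ∧ p.mass = 1 ∧
        ∀ x, (f x).support = s → ∃ v ∈ s, f x v ≤ (1 - c) * p v) := by
    intro s
    by_cases hs : s.card = k + 2
    · obtain ⟨p, h1, h2, h3, h4⟩ := hmiss s hs
      have h0 : ∀ v, 0 ≤ p v := by
        intro v
        by_cases hv : v ∈ s
        · exact hδ.le.trans (h2 v hv)
        · rw [Finsupp.notMem_support_iff.mp fun h => hv (h1 h)]
      refine ⟨p, h1, h0, fun v => ?_, fun _ => ⟨h2, h3, h4⟩⟩
      by_cases hv : v ∈ s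
      · rw [← h3, Finsupp.mass_eq_sum _ h1]
        exact Finset.single_le_sum (f := fun v => p v) (fun v _ => h0 v) hv
      · rw [Finsupp.notMem_support_iff.mp fun h => hv (h1 h)]; exact zero_le_one
    -- Off the top dimension p = 0, and below t = 0, so the projection leaves lower simplices fixed.
    · exact ⟨0, by simp, by simp, by simp, fun h => absurd h hs⟩
  choose p hps hp0 hp1 hp using hp
  -- Here t is the largest weight with f x - t p ≥ 0, so f x = t p + (1 - t) g x with g x on the
  -- boundary. Missing p means t ≤ 1 - c.
  have ht : ∀ x, ∃ t : ℝ, 0 ≤ t ∧ ((f x).support.card ≠ k + 2 → t = 0) ∧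
      ((f x).support.card = k + 2 →
        (∀ v ∈ (f x).support, t ≤ f x v / p (f x).support v) ∧
        ∃ v ∈ (f x).support, t = f x v / p (f x).support v) := by
    intro x
    by_cases hx : (f x).support.card = k + 2
    · have hne : (f x).support.Nonempty := by rw [← Finset.card_pos]; omega
      obtain ⟨v, hv, hmin⟩ := Finset.exists_min_image _
        (fun v => f x v / p (f x).support v) hne
      exact ⟨_, div_nonneg (hf.nonneg x v) (hp0 _ v), fun h => absurd hx h,
        fun _ => ⟨hmin, v, hv, rfl⟩⟩
    · exact ⟨0, le_rfl, fun _ => rfl, fun h => absurd h hx⟩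
  choose t ht0 htz ht using ht
  have htc : ∀ x, c ≤ 1 - t x := by
    intro x
    by_cases hx : (f x).support.card = k + 2
    · obtain ⟨hpl, -, hpm⟩ := hp _ hx
      obtain ⟨v, hv, hle⟩ := hpm x rfl
      have h1 := (ht x hx).1 v hv
      have h2 := (div_le_iff₀ (hδ.trans_le (hpl v hv))).mpr hle
      linarith
    · rw [htz x hx]; linarith
  have htp : ∀ x v, t x * p (f x).support v ≤ f x v := by
    intro x v
    by_cases hx : (f x).support.card = k + 2
    · by_cases hv : v ∈ (f x).support
      · exact (le_div_iff₀ (hδ.trans_le ((hp _ hx).1 v hv))).mp ((ht x hx).1 v hv)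
      · rw [Finsupp.notMem_support_iff.mp fun h => hv (hps _ h), mul_zero]
        exact hf.nonneg x v
    · rw [htz x hx, zero_mul]
      exact hf.nonneg x v
  set B : ℝ := L / r * δ⁻¹ with hB
  have hB0 : 0 < B := by positivity
  have hstep : ∀ x y v, (f x).support.card = k + 2 → v ∈ (f x).support →
      t x ≤ f y v / p (f x).support v + B * dist x y := by
    intro x y v hx hv
    have hpv := (hp _ hx).1 v hv
    have hpv0 := hδ.trans_le hpv
    have h1 : f x v ≤ f y v + L / r * dist x y := by
      linarith [(abs_le.mp (hf.lip x y v)).2]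
    calc t x ≤ f x v / p (f x).support v := (ht x hx).1 v hv
      _ ≤ (f y v + L / r * dist x y) / p (f x).support v :=
        div_le_div_of_nonneg_right h1 hpv0.le
      _ = f y v / p (f x).support v + L / r * dist x y * (p (f x).support v)⁻¹ := by
        rw [add_div, div_eq_mul_inv (L / r * dist x y)]
      _ ≤ f y v / p (f x).support v + L / r * dist x y * δ⁻¹ := by gcongr
      _ = _ := by rw [hB]; ring
  -- Compatibility across simplices: a top-dimensional support different from that of y has a vertex
  -- v with f y v = 0, which forces t x to be small.
  have hne : ∀ x y, (f x).support ≠ (f y).support → t x ≤ B * dist x y := by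
    intro x y hxy
    by_cases hx : (f x).support.card = k + 2
    · obtain ⟨v, hv, hvy⟩ : ∃ v ∈ (f x).support, v ∉ (f y).support := by
        by_contra! hsub
        exact hxy (Finset.eq_of_subset_of_card_le hsub (by rw [hx]; exact hf.card_le y))
      have := hstep x y v hx hv
      rwa [Finsupp.notMem_support_iff.mp hvy, zero_div, zero_add] at this
    · rw [htz x hx]; positivity
  have hle : ∀ x y, t x ≤ t y + B * dist x y := by
    intro x y
    by_cases hxy : (f x).support = (f y).support
    · by_cases hx : (f x).support.card = k + 2
      · obtain ⟨v, hv, hvy⟩ := (ht y (hxy ▸ hx)).2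
        have := hstep x y v hx (hxy ▸ hv)
        rwa [hxy, ← hvy] at this
      · rw [htz x hx]
        have := ht0 y
        positivity
    · linarith [hne x y hxy, ht0 y]
  have htl : ∀ x y, |t x - t y| ≤ B * dist x y := by
    intro x y
    have h1 := hle y x
    rw [dist_comm] at h1
    exact abs_le.mpr ⟨by linarith, by linarith [hle x y]⟩
  have hul : ∀ x y v,
      |t x * p (f x).support v - t y * p (f y).support v| ≤ B * dist x y := by
    intro x y v
    by_cases hxy : (f x).support = (f y).support
    · rw [hxy, ← sub_mul, abs_mul, abs_of_nonneg (hp0 _ _)]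
      exact (mul_le_of_le_one_right (abs_nonneg _) (hp1 _ _)).trans (htl x y)
    · have h1 := (mul_le_of_le_one_right (ht0 x) (hp1 (f x).support v)).trans (hne x y hxy)
      have h2 := (mul_le_of_le_one_right (ht0 y) (hp1 (f y).support v)).trans
        (hne y x (Ne.symm hxy))
      rw [dist_comm y x] at h2
      have h3 := mul_nonneg (ht0 x) (hp0 (f x).support v)
      have h4 := mul_nonneg (ht0 y) (hp0 (f y).support v)
      exact abs_le.mpr ⟨by linarith, by linarith⟩
  have hg0 : ∀ x v, f x v = 0 →
      ((1 - t x)⁻¹ • (f x - t x • p (f x).support)) v = 0 := by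
    intro x v hv
    have h1 := htp x v
    rw [hv] at h1
    have h2 := h1.antisymm (mul_nonneg (ht0 x) (hp0 (f x).support v))
    simp [hv, h2]
  refine ⟨fun x => (1 - t x)⁻¹ • (f x - t x • p (f x).support), ?_, ?_, ?_, ?_, ?_⟩
  · intro x v
    exact mul_nonneg (inv_nonneg.mpr (hc.le.trans (htc x))) (sub_nonneg.mpr (htp x v))
  · intro x
    have hsub : ((1 - t x)⁻¹ • (f x - t x • p (f x).support)).support ⊆ (f x).support := by
      intro v hv
      rw [Finsupp.mem_support_iff] at hv ⊢
      exact fun h => hv (hg0 x v h)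
    by_cases hx : (f x).support.card = k + 2
    · obtain ⟨v, hv, hvt⟩ := (ht x hx).2
      have hpv := hδ.trans_le ((hp _ hx).1 v hv)
      have h0 : ((1 - t x)⁻¹ • (f x - t x • p (f x).support)) v = 0 := by
        simp only [Finsupp.smul_apply, Finsupp.sub_apply, smul_eq_mul]
        rw [(eq_div_iff hpv.ne').mp hvt, sub_self, mul_zero]
      have := Finset.card_lt_card (hsub.ssubset_of_ne fun h => by
        rw [← h] at hv
        exact Finsupp.mem_support_iff.mp hv h0)
      omega
    · have := Finset.card_le_card hsub
      have := hf.card_le x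
      omega
  · intro x
    rw [map_smul, map_sub, map_smul, hf.mass_eq, smul_eq_mul, smul_eq_mul]
    by_cases hx : (f x).support.card = k + 2
    · rw [(hp _ hx).2.1, mul_one, inv_mul_cancel₀ (hc.trans_le (htc x)).ne']
    · simp [htz x hx]
  · intro x y v
    simp only [Finsupp.smul_apply, Finsupp.sub_apply, smul_eq_mul, inv_mul_eq_div]
    have hnum : |f x v - t x * p (f x).support v - (f y v - t y * p (f y).support v)| ≤
        L / r * dist x y + B * dist x y := by
      rw [sub_sub_sub_comm]
      exact (abs_sub _ _).trans (add_le_add (hf.lip x y v) (hul x y v))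
    have hden : |(1 - t x) - (1 - t y)| ≤ B * dist x y := by
      rw [sub_sub_sub_cancel_left, abs_sub_comm]
      exact htl x y
    have hmass : f y v - t y * p (f y).support v ≤ 1 - t y := by
      have hs : ∀ w ∈ (f y).support, 0 ≤ f y w - t y * p (f y).support w :=
        fun w _ => sub_nonneg.mpr (htp y w)
      by_cases hv : v ∈ (f y).support
      · refine (Finset.single_le_sum hs hv).trans_eq ?_
        rw [Finset.sum_sub_distrib, ← Finset.mul_sum, ← Finsupp.mass_eq_sum _ subset_rfl,
          ← Finsupp.mass_eq_sum _ (hps _), hf.mass_eq]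
        by_cases hy : (f y).support.card = k + 2
        · rw [(hp _ hy).2.1, mul_one]
        · simp [htz y hy]
      · rw [Finsupp.notMem_support_iff.mp hv,
          Finsupp.notMem_support_iff.mp fun h => hv (hps _ h)]
        linarith [htc y]
    refine (abs_div_sub_div_le hc (htc x) (htc y) hnum hden (sub_nonneg.mpr (htp y v))
      hmass).trans_eq ?_
    rw [hB]
    field_simp
    ring
  · intro x y v hx hy
    exact hf.star x y v (fun h => hx (hg0 x v h)) (fun h => hy (hg0 y v h))

/-! ### Descent on the dimension -/

/-- Metric spaces with doubling constant `N` have star bounded maps of dimension `m` at every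
scale, with a uniform Lipschitz constant. -/
def HasStarBoundedMaps (N m : ℕ) : Prop :=
  ∃ L : ℝ, 0 < L ∧ ∀ (X : Type u) [MetricSpace X], IsDoublingConstant X N → ∀ r : ℝ, 0 < r →
    ∃ (V : Type u) (f : X → V →₀ ℝ), IsStarBounded f m L r

theorem hasStarBoundedMaps_sq (N : ℕ) : HasStarBoundedMaps.{u} N (N ^ 2) :=
  ⟨4 * (1 + 2 * (N : ℝ) ^ 2), by positivity, fun _ _ h _ hr => h.exists_isStarBounded hr⟩

theorem HasStarBoundedMaps.mono {N m m' : ℕ} (hm : m ≤ m') (h : HasStarBoundedMaps.{u} N m) :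
    HasStarBoundedMaps.{u} N m' := by
  obtain ⟨L, hL, h⟩ := h
  refine ⟨L, hL, fun X _ hX r hr => ?_⟩
  obtain ⟨V, f, hf⟩ := h X hX r hr
  exact ⟨V, f, hf.nonneg, fun x => (hf.card_le x).trans (by omega), hf.mass_eq, hf.lip, hf.star⟩

theorem HasStarBoundedMaps.lower {N k : ℕ} (hN : N < 2 ^ (k + 1))
    (h : HasStarBoundedMaps.{u} N (k + 1)) : HasStarBoundedMaps.{u} N k := by
  obtain ⟨L, hL, h⟩ := h
  obtain ⟨i, hi⟩ := pow_unbounded_of_one_lt (16 * L * (((k + 1 : ℕ) : ℝ) + 1)) one_lt_two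
  -- The grid has K = 2^j values per coordinate and J = i + j; the factor 2^i pays for L and the
  -- dimension.
  obtain ⟨j, hj⟩ := exists_pow_add_lt_two_pow hN i
  have hK : (1 : ℝ) ≤ ((2 ^ j : ℕ) : ℝ) := by exact_mod_cast Nat.one_le_two_pow
  have hKJ : 16 * L * ((2 ^ j : ℕ) : ℝ) * (((k + 1 : ℕ) : ℝ) + 1) ≤ 2 ^ (i + j) := by
    rw [pow_add, Nat.cast_pow, Nat.cast_ofNat, mul_right_comm]
    exact mul_le_mul_of_nonneg_right hi.le (by positivity)
  have hc1 : 1 / (8 * ((2 ^ j : ℕ) : ℝ) * (((k + 1 : ℕ) : ℝ) + 1)) ≤ 1 := by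
    rw [div_le_one (by positivity)]
    nlinarith [(Nat.cast_nonneg (k + 1) : (0 : ℝ) ≤ ((k + 1 : ℕ) : ℝ))]
  refine ⟨L * (1 + 2 / (1 / (2 * (((k + 1 : ℕ) : ℝ) + 1)))) /
    (1 / (8 * ((2 ^ j : ℕ) : ℝ) * (((k + 1 : ℕ) : ℝ) + 1))), by positivity, fun X _ hX r hr => ?_⟩
  obtain ⟨V, f, hf⟩ := h X hX r hr
  exact ⟨V, hf.exists_lower hL hr (by positivity) (by positivity) hc1 fun s hs =>
    hf.exists_missed hX hL hr (Nat.two_pow_pos j) hKJ hj s hs⟩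

theorem hasStarBoundedMaps_log (N : ℕ) : HasStarBoundedMaps.{u} N (Nat.log 2 N) := by
  have key : ∀ k, HasStarBoundedMaps.{u} N (Nat.log 2 N + k) →
      HasStarBoundedMaps.{u} N (Nat.log 2 N) := by
    intro k
    induction k with
    | zero => exact id
    | succ k ih =>
      intro h
      refine ih (HasStarBoundedMaps.lower ?_ h)
      exact (Nat.lt_pow_succ_log_self one_lt_two N).trans_le
        (Nat.pow_le_pow_right two_pos (by omega))
  exact key (N ^ 2) ((hasStarBoundedMaps_sq N).mono (Nat.le_add_left _ _))

/-! ### Realization as a uniform complex -/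

/-- The nerve of a map to simplices, given by barycentric coordinates, together with the simplex
on the vertices `E`. -/
def simplicialNerve {X V : Type*} (f : X → V →₀ ℝ) (E : Finset V) : AbstractSimplicialComplex V where
  faces := {s | s.Nonempty ∧ ((∃ x, s ⊆ (f x).support) ∨ (∃ v, s ⊆ {v}) ∨ s ⊆ E)}
  isRelLowerSet_faces := by
    rintro s ⟨hs, h⟩
    refine ⟨hs, fun t hts ht => ⟨ht, ?_⟩⟩
    rcases h with ⟨x, h⟩ | ⟨v, h⟩ | h
    · exact Or.inl ⟨x, hts.trans h⟩
    · exact Or.inr (Or.inl ⟨v, hts.trans h⟩)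
    · exact Or.inr (Or.inr (hts.trans h))
  singleton_mem v := ⟨Finset.singleton_nonempty v, Or.inr (Or.inl ⟨v, subset_rfl⟩)⟩

/-- A finitely supported function as an element of `ℓ²`. -/
def Finsupp.toL2 {V : Type*} (f : V →₀ ℝ) : lp (fun _ : V => ℝ) 2 :=
  ⟨fun v => f v, (memℓp_zero f.hasFiniteSupport).of_exponent_ge zero_le⟩

theorem Finsupp.toL2_apply {V : Type*} (f : V →₀ ℝ) (v : V) : f.toL2 v = f v := rfl

/-- At most 2(n+1) coordinates differ; the square root of that number is bounded by the number
itself. -/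
theorem Finsupp.dist_toL2_le {V : Type*} {f g : V →₀ ℝ} {n : ℕ} {b : ℝ}
    (hf : f.support.card ≤ n + 1) (hg : g.support.card ≤ n + 1) (h : ∀ v, |f v - g v| ≤ b)
    (hb : 0 ≤ b) : dist f.toL2 g.toL2 ≤ 2 * ((n : ℝ) + 1) * b := by
  classical
  rw [dist_eq_norm]
  refine lp.norm_le_of_forall_sum_le (by norm_num) (by positivity) fun t => ?_
  simp only [lp.coeFn_sub, Pi.sub_apply, Finsupp.toL2_apply, ENNReal.toReal_ofNat,
    Real.rpow_ofNat, Real.norm_eq_abs]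
  have hcard : (t ∩ (f.support ∪ g.support)).card ≤ 2 * (n + 1) := by
    have h1 := Finset.card_union_le f.support g.support
    have h2 := Finset.card_le_card
      (Finset.inter_subset_right : t ∩ (f.support ∪ g.support) ⊆ f.support ∪ g.support)
    omega
  have hcard' : ((t ∩ (f.support ∪ g.support)).card : ℝ) ≤ 2 * ((n : ℝ) + 1) := by
    exact_mod_cast hcard
  calc ∑ v ∈ t, |f v - g v| ^ 2
      = ∑ v ∈ t ∩ (f.support ∪ g.support), |f v - g v| ^ 2 := by
        refine (Finset.sum_subset Finset.inter_subset_left fun v hv hv' => ?_).symm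
        have : v ∉ f.support ∪ g.support := fun h => hv' (Finset.mem_inter.mpr ⟨hv, h⟩)
        simp only [Finset.mem_union, Finsupp.mem_support_iff, not_or, not_not] at this
        simp [this.1, this.2]
    _ ≤ (t ∩ (f.support ∪ g.support)).card • b ^ 2 :=
        Finset.sum_le_card_nsmul _ _ _ fun v _ => pow_le_pow_left₀ (abs_nonneg _) (h v) 2
    _ ≤ 2 * ((n : ℝ) + 1) * b ^ 2 := by
        rw [nsmul_eq_mul]
        exact mul_le_mul_of_nonneg_right hcard' (sq_nonneg b)
    _ ≤ (2 * ((n : ℝ) + 1) * b) ^ 2 := by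
        rw [mul_pow]
        refine mul_le_mul_of_nonneg_right (le_self_pow₀ ?_ two_ne_zero) (sq_nonneg b)
        linarith [(Nat.cast_nonneg n : (0 : ℝ) ≤ n)]

section Nerve

variable {X : Type u} [MetricSpace X] {V : Type u} {f : X → V →₀ ℝ} {n : ℕ} {L r : ℝ}

theorem IsStarBounded.support_nonempty (hf : IsStarBounded f n L r) (x : X) :
    (f x).support.Nonempty := by
  rw [Finsupp.support_nonempty_iff]
  intro h
  have := hf.mass_eq x
  rw [h, map_zero] at this
  exact zero_ne_one this

theorem IsStarBounded.dim_simplicialNerve (hf : IsStarBounded f n L r) {E : Finset V}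
    (hE : E.card = n + 1) : UniformComplex.dim (simplicialNerve f E) = ((n : ℕ∞) : WithBot ℕ∞) := by
  apply le_antisymm
  · refine iSup₂_le fun s hs => ?_
    have : s.card - 1 ≤ n := by
      obtain ⟨-, ⟨x, h⟩ | ⟨v, h⟩ | h⟩ := hs
      · have := Finset.card_le_card h
        have := hf.card_le x
        omega
      · have := Finset.card_le_card h
        rw [Finset.card_singleton] at this
        omega
      · have := Finset.card_le_card h
        omega
    exact_mod_cast this
  · refine le_iSup₂_of_le E ⟨Finset.card_pos.mp (by omega), Or.inr (Or.inr subset_rfl)⟩ ?_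
    rw [hE, Nat.add_sub_cancel]

theorem IsStarBounded.toL2_mem_space (hf : IsStarBounded f n L r) (E : Finset V) (x : X) :
    (f x).toL2 ∈ UniformComplex.space (simplicialNerve f E) := by
  refine Set.mem_biUnion (x := (f x).support)
    ⟨hf.support_nonempty x, Or.inl ⟨x, subset_rfl⟩⟩ ⟨hf.nonneg x, ?_, ?_⟩
  · exact fun v hv => Finsupp.notMem_support_iff.mp hv
  · exact (Finsupp.mass_eq_sum _ subset_rfl).symm.trans (hf.mass_eq x)

/-- Points over a face contained in the support of f z each share a vertex with z, so they are
within r of z. -/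
theorem IsStarBounded.isCobounded (hf : IsStarBounded f n L r) {E : Finset V}
    (hE : ∀ x, ∀ v ∈ E, f x v = 0) :
    UniformComplex.IsCobounded (simplicialNerve f E) (2 * r)
      fun x => ⟨(f x).toL2, hf.toL2_mem_space E x⟩ := by
  intro s hs
  refine Metric.ediam_le fun x hx y hy => ?_
  rw [edist_dist]
  refine ENNReal.ofReal_le_ofReal ?_
  have hv : ∀ x, (f x).toL2 ∈ UniformComplex.simplex s → ∃ v ∈ s, f x v ≠ 0 := by
    intro x hx
    obtain ⟨v, hv⟩ := hf.support_nonempty x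
    rw [Finsupp.mem_support_iff] at hv
    exact ⟨v, by_contra fun hvs => hv (hx.2.1 v hvs), hv⟩
  obtain ⟨v, hvs, hv0⟩ := hv x hx
  obtain ⟨w, hws, hw0⟩ := hv y hy
  obtain ⟨-, ⟨z, h⟩ | ⟨q, h⟩ | h⟩ := hs
  · have h1 := hf.star x z v hv0 (Finsupp.mem_support_iff.mp (h hvs))
    have h2 := hf.star y z w hw0 (Finsupp.mem_support_iff.mp (h hws))
    linarith [dist_triangle_right x y z]
  · rw [Finset.mem_singleton.mp (h hvs)] at hv0
    rw [Finset.mem_singleton.mp (h hws)] at hw0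
    have h1 := hf.star x y q hv0 hw0
    linarith [dist_nonneg (x := x) (y := y)]
  · exact absurd (hE x v (h hvs)) hv0

theorem IsStarBounded.embDomain (hf : IsStarBounded f n L r) (hL : 0 ≤ L) (hr : 0 ≤ r)
    {W : Type u} (e : V ↪ W) : IsStarBounded (fun x => (f x).embDomain e) n L r := by
  have hcases : ∀ w, (∃ v, e v = w) ∨ ∀ x, (f x).embDomain e w = 0 := fun w => by
    by_cases h : w ∈ Set.range e
    · exact Or.inl h
    · exact Or.inr fun x => Finsupp.embDomain_of_notMem_range e (f x) w h
  refine ⟨fun x w => ?_, fun x => ?_, fun x => ?_, fun x y w => ?_, fun x y w hx hy => ?_⟩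
  · obtain ⟨v, rfl⟩ | h := hcases w
    · rw [Finsupp.embDomain_apply_self]; exact hf.nonneg x v
    · exact (h x).ge
  · rw [Finsupp.support_embDomain, Finset.card_map]; exact hf.card_le x
  · rw [Finsupp.mass, Finsupp.linearCombination_embDomain]; exact hf.mass_eq x
  · obtain ⟨v, rfl⟩ | h := hcases w
    · rw [Finsupp.embDomain_apply_self, Finsupp.embDomain_apply_self]; exact hf.lip x y v
    · rw [h, h, sub_self, abs_zero]; positivity
  · obtain ⟨v, rfl⟩ | h := hcases w
    · rw [Finsupp.embDomain_apply_self] at hx hy; exact hf.star x y v hx hy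
    · exact absurd (h x) hx

end Nerve

theorem mainTheorem8 (N : ℕ) (hN : 0 < N) :
    ∃ D : ℝ, 0 < D ∧
      ∀ (X : Type u) [MetricSpace X], IsDoublingConstant X N →
        ∀ ε : ℝ, 0 < ε →
          ∃ (V : Type u) (P : AbstractSimplicialComplex V),
            UniformComplex.dim P = ((⌊Real.logb 2 (N : ℝ)⌋₊ : ℕ∞) : WithBot ℕ∞) ∧
            ∃ F : X → UniformComplex.space P,
              LipschitzWith ε.toNNReal F ∧ UniformComplex.IsCobounded P (D / ε) F := by
  have hlog : ⌊Real.logb 2 (N : ℝ)⌋₊ = Nat.log 2 N := by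
    exact_mod_cast Real.natFloor_logb_natCast 2 N
  rw [hlog]
  obtain ⟨L, hL, h⟩ := hasStarBoundedMaps_log.{u} N
  set n := Nat.log 2 N
  have hn : (0 : ℝ) < 2 * ((n : ℝ) + 1) := by positivity
  refine ⟨2 * (2 * ((n : ℝ) + 1) * L), by positivity, fun X _ hX ε hε => ?_⟩
  obtain ⟨r, hrdef⟩ : ∃ r, r = 2 * ((n : ℝ) + 1) * L / ε := ⟨_, rfl⟩
  have hr : 0 < r := by rw [hrdef]; positivity
  obtain ⟨V, f₀, hf₀⟩ := h X hX r hr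
  -- The n + 1 new vertices span a simplex that meets no support. It forces the dimension to be
  -- exactly n without affecting coboundedness.
  have hf := hf₀.embDomain hL.le hr.le (Function.Embedding.inl : V ↪ V ⊕ ULift.{u} (Fin (n + 1)))
  refine ⟨_, simplicialNerve _ (Finset.univ.map Function.Embedding.inr),
    hf.dim_simplicialNerve (by simp), fun x => ⟨_, hf.toL2_mem_space _ x⟩, ?_, ?_⟩
  · refine LipschitzWith.of_dist_le_mul fun x y => ?_
    rw [Real.coe_toNNReal _ hε.le, Subtype.dist_eq]
    refine (Finsupp.dist_toL2_le (hf.card_le x) (hf.card_le y) (hf.lip x y)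
      (by positivity)).trans_eq ?_
    rw [hrdef]
    field_simp
  · rw [mul_div_assoc, ← hrdef]
    refine hf.isCobounded fun x v hv => ?_
    obtain ⟨i, -, rfl⟩ := Finset.mem_map.mp hv
    exact Finsupp.embDomain_of_notMem_range _ _ _ (by simp)
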